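/- For integers $d\ge 2$ and $n\ge 1$ let $D_{n,d}$ be the graph with vertex set $\{1,\dots,n\}$ defined inductively as follows: $D_{1,d}$ is the single vertex $1$, and $D_{n,d}$ is obtained from $D_{n-1,d}$ by attaching the new vertex $n$ as a leaf to the smallest numbered vertex whose degree in $D_{n-1,d}$ is at most $d$. Regard $D_{n,d}$ as rooted at vertex $1$, the level of a vertex being its distance from the root, and count a vertex among its own descendants. For an integer $k\ge 0$ let $n_k$ be the smallest $n$ such that $D_{n,d}$ contains exactly one descendant of vertex $2$ at level $k+1$. The Wiener index $W(G)$ of a finite connected graph $G$ is the sum of the distances $d(u,v)$ over all unordered pairs $\{u,v\}$ of distinct vertices of $G$. Then $$n_k=2+(d+1)\frac{d^k-1}{d-1},$$ the complete dendrimer $D_{n_k-1,d}$ is connected, and its Wiener index is $$W(D_{n_k-1,d})=\frac{d^{2k}\left[kd^3+(k-2)d^2-(k+3)d-(k+1)\right]+2d^k(d+1)^2-(d+1)}{(d-1)^3}.$$ -/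

import Mathlib

/-- The Wiener index: the sum of the distances `d(u, v)` over all unordered pairs `{u, v}` of
distinct vertices (elements of `Sym2 V` off the diagonal). The graphs considered are connected,
so that `G.dist` is the graph distance. -/
noncomputable def wienerIndex {V : Type*} [Fintype V] (G : SimpleGraph V) : ℕ :=
  open Classical in
  ∑ e ∈ (Finset.univ : Finset (Sym2 V)).filter (fun e => ¬ e.IsDiag),
    Sym2.lift ⟨fun u v => G.dist u v, fun _ _ => G.dist_comm⟩ e

/-- The edges of the `d`-ary dendrimer on the nodes `1, …, n`, drawn on the vertex type `ℕ` (all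
numbers outside `{1, …, n}` are isolated). There is no edge for `n ≤ 1`; the node `n + 2` is
attached to the smallest numbered node in `{1, …, n + 1}` whose degree so far is at most `d`. -/
noncomputable def dendrimerOnNat (d : ℕ) : ℕ → SimpleGraph ℕ
  | 0 => ⊥
  | 1 => ⊥
  | n + 2 =>
    dendrimerOnNat d (n + 1) ⊔
      SimpleGraph.edge
        (sInf {v : ℕ | v ∈ Set.Icc 1 (n + 1) ∧
          ((dendrimerOnNat d (n + 1)).neighborSet v).ncard ≤ d})
        (n + 2)

/-- The `d`-ary dendrimer `D_{n,d}`, with vertex set `{1, …, n}`. -/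
noncomputable def dendrimer (n d : ℕ) : SimpleGraph (Set.Icc 1 n) :=
  (dendrimerOnNat d n).induce (Set.Icc 1 n)

/-- In a tree `G` rooted at `r`, the vertex `v` is a descendant of `u` (possibly `u` itself):
`u` lies on the path from `r` to `v`. -/
def IsDescendant {V : Type*} (G : SimpleGraph V) (r u v : V) : Prop :=
  ∃ p : G.Walk r v, p.IsPath ∧ u ∈ p.support

/-- The descendants of vertex `2` at level `k + 1` of `D_{n,d}`, rooted at vertex `1`; the level
of a vertex is its distance from the root. -/
def descendantsOfTwoAtLevelSucc (n d k : ℕ) : Set ℕ :=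
  {v | (dendrimerOnNat d n).dist 1 v = k + 1 ∧ IsDescendant (dendrimerOnNat d n) 1 2 v}

/-- `n_k`: the number of vertices in the (first) `d`-ary dendrimer with exactly one descendant
of vertex `2` at level `k + 1`. -/
noncomputable def completionIndex (d k : ℕ) : ℕ :=
  sInf {n : ℕ | (descendantsOfTwoAtLevelSucc n d k).ncard = 1}

/-! The greedy rule fills nodes in numerical order, so node `m ≥ 2` always hangs from `(m - 3) / d +
1`. Truncated subtraction gives `m = 2` the parent `1`, so the root has the `d + 1` potential
children `2, …, d + 2`, and `p + 1` with `p ≥ 1` has the block `d * p + 3, …, d * p + d + 2`.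

Each new node is a leaf, so distances never change later: for `u < v`, the distance from `u` to `v`
is one more than that from `u` to the parent of `v`, and two distinct nodes of one level are two
further apart than their parents. Levels are intervals `(c k, c (k + 1)]` with `c (k + 1) = d * c k
+ 2`. As `c k + 1` is the first node at level `k + 1` and descends from `2`, `completionIndex_eq`
follows.

Beyond the first level, the parent map between consecutive levels is `d`-to-one. Distance sums
within a level, across levels, and in total therefore satisfy linear recurrences (`levelSum_succ`,
`crossSum_succ`, `totalSum_succ`), solved by induction in `dendrimer_sums_eq`. The Wiener index is
half the total. -/

/-! ### The parent map and the edges -/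

/-- The parent of the node `m ≥ 2` of the `d`-ary dendrimer. -/
def dendrimerParent (d m : ℕ) : ℕ := (m - 3) / d + 1

theorem dendrimerParent_pos (d m : ℕ) : 1 ≤ dendrimerParent d m := Nat.le_add_left _ _

theorem dendrimerParent_two (d : ℕ) : dendrimerParent d 2 = 1 := by simp [dendrimerParent]

theorem dendrimerParent_eq_iff {d m p : ℕ} (hd : 2 ≤ d) (hm : 3 ≤ m) :
    dendrimerParent d m = p + 1 ↔ d * p + 3 ≤ m ∧ m ≤ d * p + d + 2 := by
  unfold dendrimerParent
  rw [Nat.add_right_cancel_iff, Nat.div_eq_iff (by omega), mul_comm p d]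
  omega

theorem dendrimerParent_lt {d m : ℕ} (hm : 2 ≤ m) : dendrimerParent d m < m := by
  unfold dendrimerParent
  have := Nat.div_le_self (m - 3) d
  omega

theorem dendrimerParent_mono (d : ℕ) {a b : ℕ} (h : a ≤ b) :
    dendrimerParent d a ≤ dendrimerParent d b :=
  Nat.add_le_add_right (Nat.div_le_div_right (Nat.sub_le_sub_right h 3)) 1

/-- Every node before the parent of `n + 2` already has all its children, hence degree `d + 1`; that
parent still lacks the child `n + 2`, hence has degree at most `d`. -/
theorem greedy_vertex_eq_dendrimerParent {d n : ℕ} (hd : 2 ≤ d) {G : SimpleGraph ℕ}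
    (hG : ∀ u v, G.Adj u v ↔ (u = dendrimerParent d v ∧ 2 ≤ v ∧ v ≤ n + 1) ∨
      (v = dendrimerParent d u ∧ 2 ≤ u ∧ u ≤ n + 1)) :
    sInf {v : ℕ | v ∈ Set.Icc 1 (n + 1) ∧ (G.neighborSet v).ncard ≤ d}
      = dendrimerParent d (n + 2) := by
  have hfin : ∀ v, (G.neighborSet v).Finite := by
    intro v
    refine (Set.finite_Icc 0 (n + 1)).subset fun w hw => ?_
    rw [SimpleGraph.mem_neighborSet, hG] at hw
    rcases hw with ⟨-, -, h⟩ | ⟨h, h1, h2⟩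
    · exact ⟨by omega, h⟩
    · have := dendrimerParent_lt (d := d) h1
      exact ⟨by omega, by omega⟩
  have hlt := dendrimerParent_lt (d := d) (m := n + 2) (by omega)
  have hpos := dendrimerParent_pos d (n + 2)
  apply le_antisymm
  · refine Nat.sInf_le ⟨⟨hpos, by omega⟩, ?_⟩
    obtain ⟨p, hp⟩ : ∃ p, dendrimerParent d (n + 2) = p + 1 := ⟨_, rfl⟩
    rw [hp]
    rcases Nat.eq_zero_or_pos n with rfl | hn
    · have : G.neighborSet (p + 1) = ∅ := by
        ext w
        simp only [SimpleGraph.mem_neighborSet, hG, Set.mem_empty_iff_false, iff_false]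
        omega
      simp [this]
    have hb := (dendrimerParent_eq_iff hd (by omega)).1 hp
    rcases Nat.eq_zero_or_pos p with rfl | hp0
    · have hsub : G.neighborSet (0 + 1) ⊆ (Finset.Icc 2 (n + 1) : Finset ℕ) := by
        intro w hw
        rw [SimpleGraph.mem_neighborSet, hG] at hw
        simp only [Finset.coe_Icc, Set.mem_Icc]
        omega
      have := Set.ncard_le_ncard hsub (Finset.finite_toSet _)
      rw [Set.ncard_coe_finset, Nat.card_Icc] at this
      omega
    · have hsub : G.neighborSet (p + 1) ⊆
          (insert (dendrimerParent d (p + 1)) (Finset.Icc (d * p + 3) (n + 1)) : Finset ℕ) := by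
        intro w hw
        rw [SimpleGraph.mem_neighborSet, hG] at hw
        simp only [Finset.coe_insert, Finset.coe_Icc, Set.mem_insert_iff, Set.mem_Icc]
        rcases hw with ⟨h, h1, h2⟩ | ⟨h, -, -⟩
        · right
          have h3 : 3 ≤ w := by
            by_contra hw3
            obtain rfl : w = 2 := by omega
            rw [dendrimerParent_two] at h
            omega
          have := (dendrimerParent_eq_iff hd h3).1 h.symm
          omega
        · exact Or.inl h
      have := Set.ncard_le_ncard hsub (Finset.finite_toSet _)
      rw [Set.ncard_coe_finset] at this
      have h2 := Finset.card_insert_le (dendrimerParent d (p + 1)) (Finset.Icc (d * p + 3) (n + 1))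
      rw [Nat.card_Icc] at h2
      omega
  -- The last node `n + 1` has at most one neighbour, so the set is nonempty.
  · refine le_csInf ⟨n + 1, ⟨by omega, le_rfl⟩, ?_⟩ ?_
    · have hsub : G.neighborSet (n + 1) ⊆
          (insert (dendrimerParent d (n + 1)) ∅ : Finset ℕ) := by
        intro w hw
        rw [SimpleGraph.mem_neighborSet, hG] at hw
        rcases hw with ⟨h, h1, h2⟩ | ⟨h, -, -⟩
        · have := dendrimerParent_lt (d := d) h1
          omega
        · simpa using h
      have := Set.ncard_le_ncard hsub (Finset.finite_toSet _)
      rw [Set.ncard_coe_finset] at this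
      simp at this
      omega
    · rintro v ⟨⟨hv1, hv2⟩, hv⟩
      by_contra hlt'
      obtain ⟨q, rfl⟩ : ∃ q, v = q + 1 := ⟨v - 1, by omega⟩
      obtain ⟨p, hp⟩ : ∃ p, dendrimerParent d (n + 2) = p + 1 := ⟨_, rfl⟩
      have hn : 0 < n := by
        rcases Nat.eq_zero_or_pos n with rfl | hn
        · rw [zero_add, dendrimerParent_two] at hp hlt'
          omega
        · exact hn
      have hb := (dendrimerParent_eq_iff hd (by omega)).1 hp
      have hqp : d * (q + 1) ≤ d * p := Nat.mul_le_mul_left _ (by omega)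
      rw [mul_add, mul_one] at hqp
      have key : ∃ s : Finset ℕ, (s : Set ℕ) ⊆ G.neighborSet (q + 1) ∧ s.card = d + 1 := by
        rcases Nat.eq_zero_or_pos q with rfl | hq
        · refine ⟨Finset.Icc 2 (d + 2), ?_, by simp⟩
          intro w hw
          simp only [Finset.coe_Icc, Set.mem_Icc] at hw
          rw [SimpleGraph.mem_neighborSet, hG]
          refine Or.inl ⟨?_, by omega, by omega⟩
          rcases hw.1.eq_or_lt with rfl | h3
          · rw [dendrimerParent_two]
          · exact ((dendrimerParent_eq_iff hd h3).2 (by omega)).symm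
        · have hlt2 := dendrimerParent_lt (d := d) (m := q + 1) (by omega)
          have hle : q ≤ d * q := Nat.le_mul_of_pos_left _ (by omega)
          refine ⟨insert (dendrimerParent d (q + 1)) (Finset.Icc (d * q + 3) (d * q + d + 2)),
            ?_, ?_⟩
          · intro w hw
            simp only [Finset.coe_insert, Finset.coe_Icc, Set.mem_insert_iff, Set.mem_Icc] at hw
            rw [SimpleGraph.mem_neighborSet, hG]
            rcases hw with h | h
            · exact Or.inr ⟨h, by omega, by omega⟩
            · exact Or.inl ⟨((dendrimerParent_eq_iff hd (by omega)).2 h).symm, by omega, by omega⟩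
          · rw [Finset.card_insert_of_notMem (by simp only [Finset.mem_Icc]; omega), Nat.card_Icc]
            omega
      obtain ⟨s, hs, hcard⟩ := key
      have := Set.ncard_le_ncard hs (hfin _)
      rw [Set.ncard_coe_finset] at this
      omega

theorem dendrimerOnNat_adj {d : ℕ} (hd : 2 ≤ d) (n u v : ℕ) :
    (dendrimerOnNat d n).Adj u v ↔ (u = dendrimerParent d v ∧ 2 ≤ v ∧ v ≤ n) ∨
      (v = dendrimerParent d u ∧ 2 ≤ u ∧ u ≤ n) := by
  induction n using Nat.strong_induction_on generalizing u v with
  | _ n ih =>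
    match n, ih with
    | 0, _ => simp only [dendrimerOnNat, SimpleGraph.bot_adj, false_iff]; omega
    | 1, _ => simp only [dendrimerOnNat, SimpleGraph.bot_adj, false_iff]; omega
    | n + 2, ih =>
      have ih' := ih (n + 1) (by omega)
      rw [dendrimerOnNat, greedy_vertex_eq_dendrimerParent hd ih', SimpleGraph.sup_adj, ih',
        SimpleGraph.edge_adj]
      have h := dendrimerParent_lt (d := d) (m := n + 2) (by omega)
      constructor
      · rintro ((h | h) | ⟨⟨rfl, rfl⟩ | ⟨rfl, rfl⟩, -⟩)
        · exact Or.inl ⟨h.1, h.2.1, by omega⟩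
        · exact Or.inr ⟨h.1, h.2.1, by omega⟩
        · exact Or.inl ⟨rfl, by omega, by omega⟩
        · exact Or.inr ⟨rfl, by omega, by omega⟩
      · rintro (⟨rfl, h1, h2⟩ | ⟨rfl, h1, h2⟩)
        · rcases h2.eq_or_lt with rfl | h3
          · exact Or.inr ⟨Or.inl ⟨rfl, rfl⟩, by omega⟩
          · exact Or.inl (Or.inl ⟨rfl, h1, by omega⟩)
        · rcases h2.eq_or_lt with rfl | h3
          · exact Or.inr ⟨Or.inr ⟨rfl, rfl⟩, by omega⟩
          · exact Or.inl (Or.inr ⟨rfl, h1, by omega⟩)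

/-! ### Connectedness and stability of distances -/

theorem dendrimerOnNat_adj_parent {d n v : ℕ} (hd : 2 ≤ d) (hv : 2 ≤ v) (hn : v ≤ n) :
    (dendrimerOnNat d n).Adj v (dendrimerParent d v) :=
  (dendrimerOnNat_adj hd n _ _).2 (Or.inr ⟨rfl, hv, hn⟩)

theorem dendrimerOnNat_mono {d : ℕ} (hd : 2 ≤ d) {m n : ℕ} (h : m ≤ n) :
    dendrimerOnNat d m ≤ dendrimerOnNat d n := by
  intro u v huv
  rw [dendrimerOnNat_adj hd] at huv ⊢
  omega

theorem dendrimerOnNat_reachable_one {d n v : ℕ} (hd : 2 ≤ d) (h1 : 1 ≤ v) (hn : v ≤ n) :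
    (dendrimerOnNat d n).Reachable v 1 := by
  induction v using Nat.strong_induction_on with
  | _ v ih =>
    rcases h1.eq_or_lt with rfl | h2
    · exact SimpleGraph.Reachable.refl _
    · have hlt := dendrimerParent_lt (d := d) h2
      exact (dendrimerOnNat_adj_parent hd h2 hn).reachable.trans
        (ih _ hlt (dendrimerParent_pos d v) (by omega))

theorem dendrimerOnNat_reachable {d n u v : ℕ} (hd : 2 ≤ d) (hu : u ∈ Set.Icc 1 n)
    (hv : v ∈ Set.Icc 1 n) : (dendrimerOnNat d n).Reachable u v :=
  (dendrimerOnNat_reachable_one hd hu.1 hu.2).trans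
    (dendrimerOnNat_reachable_one hd hv.1 hv.2).symm

/-- A function growing by at most one along each edge bounds walk lengths from below. -/
theorem SimpleGraph.Walk.le_add_length {V : Type*} {G : SimpleGraph V} (f : V → ℕ)
    (hf : ∀ x y, G.Adj x y → f y ≤ f x + 1) {u v : V} (p : G.Walk u v) :
    f v ≤ f u + p.length := by
  induction p with
  | nil => simp
  | cons h p ih =>
    have := hf _ _ h
    rw [SimpleGraph.Walk.length_cons]
    omega

theorem SimpleGraph.Reachable.le_add_dist {V : Type*} {G : SimpleGraph V} (f : V → ℕ)
    (hf : ∀ x y, G.Adj x y → f y ≤ f x + 1) {u v : V} (h : G.Reachable u v) :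
    f v ≤ f u + G.dist u v := by
  obtain ⟨p, hp⟩ := h.exists_walk_length_eq_dist
  exact hp ▸ p.le_add_length f hf

theorem SimpleGraph.Adj.dist_le_dist_add_one {V : Type*} {G : SimpleGraph V} {x y : V}
    (h : G.Adj x y) (u : V) : G.dist u y ≤ G.dist u x + 1 := by
  have h1 := (h.reachable).dist_triangle_right u
  rw [SimpleGraph.dist_eq_one_iff_adj.2 h] at h1
  exact h1

theorem dist_dendrimerOnNat_succ {d n u v : ℕ} (hd : 2 ≤ d) (hu : u ∈ Set.Icc 1 n)
    (hv : v ∈ Set.Icc 1 n) :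
    (dendrimerOnNat d (n + 1)).dist u v = (dendrimerOnNat d n).dist u v ∧
      (dendrimerOnNat d (n + 1)).dist u (n + 1) =
        (dendrimerOnNat d n).dist u (dendrimerParent d (n + 1)) + 1 := by
  have hun := hu
  have hvn := hv
  simp only [Set.mem_Icc] at hun hvn
  have hp1 := dendrimerParent_pos d (n + 1)
  have hp2 := dendrimerParent_lt (d := d) (m := n + 1) (by omega)
  have hmono := dendrimerOnNat_mono hd (Nat.le_add_right n 1)
  have hu' : u ∈ Set.Icc 1 (n + 1) := ⟨by omega, by omega⟩
  have hv' : v ∈ Set.Icc 1 (n + 1) := ⟨by omega, by omega⟩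
  -- The expected distance from `u` after the new leaf is attached; its growth bound along edges
  -- gives the lower bounds.
  let f : ℕ → ℕ := fun x => if x = n + 1 then
    (dendrimerOnNat d n).dist u (dendrimerParent d (n + 1)) + 1 else (dendrimerOnNat d n).dist u x
  have hfu : f u = 0 := by simp only [f]; rw [if_neg (by omega)]; exact SimpleGraph.dist_self
  have hf : ∀ x y, (dendrimerOnNat d (n + 1)).Adj x y → f y ≤ f x + 1 := by
    intro x y hxy
    by_cases hxy' : (dendrimerOnNat d n).Adj x y
    · have h := hxy'
      rw [dendrimerOnNat_adj hd] at h
      have hx : x ≠ n + 1 := by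
        rintro rfl
        rcases h with ⟨h, h1, h2⟩ | ⟨h, h1, h2⟩
        · have := dendrimerParent_lt (d := d) h1
          omega
        · omega
      have hy : y ≠ n + 1 := by
        rintro rfl
        rcases h with ⟨h, h1, h2⟩ | ⟨h, h1, h2⟩
        · omega
        · have := dendrimerParent_lt (d := d) h1
          omega
      simp only [f, if_neg hx, if_neg hy]
      exact hxy'.dist_le_dist_add_one u
    · rw [dendrimerOnNat_adj hd] at hxy hxy'
      have : (x = dendrimerParent d (n + 1) ∧ y = n + 1) ∨
          (y = dendrimerParent d (n + 1) ∧ x = n + 1) := by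
        rcases hxy with ⟨rfl, h1, h2⟩ | ⟨rfl, h1, h2⟩
        · obtain rfl : y = n + 1 := by by_contra; exact hxy' (Or.inl ⟨rfl, h1, by omega⟩)
          exact Or.inl ⟨rfl, rfl⟩
        · obtain rfl : x = n + 1 := by by_contra; exact hxy' (Or.inr ⟨rfl, h1, by omega⟩)
          exact Or.inr ⟨rfl, rfl⟩
      rcases this with ⟨rfl, rfl⟩ | ⟨rfl, rfl⟩
      · simp [f, hp2.ne]
      · simp only [f, if_neg hp2.ne, if_true]
        omega
  have hle : (dendrimerOnNat d (n + 1)).dist u (dendrimerParent d (n + 1)) ≤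
      (dendrimerOnNat d n).dist u (dendrimerParent d (n + 1)) :=
    (dendrimerOnNat_reachable hd hu ⟨hp1, by omega⟩).dist_anti hmono
  constructor
  · apply le_antisymm ((dendrimerOnNat_reachable hd hu hv).dist_anti hmono)
    have := (dendrimerOnNat_reachable hd hu' hv').le_add_dist f hf
    simpa [hfu, f, show v ≠ n + 1 by omega] using this
  · apply le_antisymm
    · have := (dendrimerOnNat_adj_parent hd (n := n + 1) (v := n + 1) (by omega)
        le_rfl).symm.dist_le_dist_add_one u
      omega
    · have := (dendrimerOnNat_reachable (n := n + 1) hd hu' ⟨by omega, le_rfl⟩).le_add_dist f hf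
      simpa [hfu, f] using this

/-- The distance of two nodes in all dendrimers that contain both. -/
noncomputable def dendrimerDist (d u v : ℕ) : ℕ := (dendrimerOnNat d (max u v)).dist u v

theorem dendrimerDist_comm (d u v : ℕ) : dendrimerDist d u v = dendrimerDist d v u := by
  rw [dendrimerDist, dendrimerDist, max_comm, SimpleGraph.dist_comm]

theorem dendrimerDist_self (d u : ℕ) : dendrimerDist d u u = 0 := SimpleGraph.dist_self

theorem dist_dendrimerOnNat {d n u v : ℕ} (hd : 2 ≤ d) (hu : u ∈ Set.Icc 1 n)
    (hv : v ∈ Set.Icc 1 n) : (dendrimerOnNat d n).dist u v = dendrimerDist d u v := by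
  have hmax : max u v ≤ n := max_le hu.2 hv.2
  induction n, hmax using Nat.le_induction with
  | base => rfl
  | succ n hn ih =>
    have hu' : u ∈ Set.Icc 1 n := ⟨hu.1, (le_max_left _ _).trans hn⟩
    have hv' : v ∈ Set.Icc 1 n := ⟨hv.1, (le_max_right _ _).trans hn⟩
    rw [(dist_dendrimerOnNat_succ hd hu' hv').1, ih hu' hv']

theorem dendrimerDist_parent_right {d u v : ℕ} (hd : 2 ≤ d) (hu : 1 ≤ u) (huv : u < v) :
    dendrimerDist d u v = dendrimerDist d u (dendrimerParent d v) + 1 := by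
  obtain ⟨n, rfl⟩ : ∃ n, v = n + 1 := ⟨v - 1, by omega⟩
  have hu' : u ∈ Set.Icc 1 n := ⟨hu, by omega⟩
  have hp := dendrimerParent_lt (d := d) (m := n + 1) (by omega)
  rw [← dist_dendrimerOnNat hd hu' ⟨dendrimerParent_pos d _, by omega⟩,
    ← (dist_dendrimerOnNat_succ hd hu' hu').2, dendrimerDist, max_eq_right huv.le]

theorem dendrimerDist_parent_parent {d u v : ℕ} (hd : 2 ≤ d) (huv : u < v)
    (hvu : dendrimerParent d v < u) :
    dendrimerDist d u v = dendrimerDist d (dendrimerParent d u) (dendrimerParent d v) + 2 := by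
  have := dendrimerParent_pos d v
  rw [dendrimerDist_parent_right hd (by omega) huv, dendrimerDist_comm,
    dendrimerDist_parent_right hd this hvu, dendrimerDist_comm]

/-! ### Levels and the completion index -/

/-- The number of nodes of the complete `d`-ary dendrimer with `k` levels below the root. -/
def completeSize (d : ℕ) : ℕ → ℕ
  | 0 => 1
  | k + 1 => d * completeSize d k + 2

theorem completeSize_pos (d k : ℕ) : 1 ≤ completeSize d k := by
  cases k <;> simp [completeSize]

theorem completeSize_lt_succ {d : ℕ} (hd : 2 ≤ d) (k : ℕ) :
    completeSize d k < completeSize d (k + 1) := by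
  have : 1 * completeSize d k ≤ d * completeSize d k := Nat.mul_le_mul_right _ (by omega)
  rw [completeSize]
  omega

theorem completeSize_mul_sub_one {d : ℕ} (k : ℕ) :
    (completeSize d k : ℚ) * ((d : ℚ) - 1) = ((d : ℚ) + 1) * (d : ℚ) ^ k - 2 := by
  induction k with
  | zero => simp [completeSize]; ring
  | succ k ih =>
    rw [completeSize]
    push_cast
    rw [pow_succ]
    linear_combination (d : ℚ) * ih

theorem dendrimerParent_mem_Ioc {d a b v : ℕ} (hd : 2 ≤ d)
    (hv : v ∈ Set.Ioc (d * a + 2) (d * b + 2)) : dendrimerParent d v ∈ Set.Ioc a b := by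
  simp only [Set.mem_Ioc] at hv ⊢
  obtain ⟨p, hp⟩ : ∃ p, dendrimerParent d v = p + 1 := ⟨_, rfl⟩
  have h := (dendrimerParent_eq_iff hd (by omega)).1 hp
  have h1 : d * a < d * (p + 1) := by rw [mul_add]; omega
  have h2 : d * p < d * b := by omega
  have := Nat.lt_of_mul_lt_mul_left h1
  have := Nat.lt_of_mul_lt_mul_left h2
  omega

theorem dendrimerParent_le_completeSize {d k v : ℕ} (hd : 2 ≤ d)
    (hv : v ≤ completeSize d (k + 1)) : dendrimerParent d v ≤ completeSize d k := by
  have h1 := completeSize_pos d k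
  by_cases h : v ≤ 2
  · have := dendrimerParent_mono d h
    rw [dendrimerParent_two] at this
    omega
  · exact (dendrimerParent_mem_Ioc hd (a := 0) ⟨by omega, hv⟩).2

theorem dendrimerDist_one_le {d k v : ℕ} (hd : 2 ≤ d) (hv : v ∈ Set.Icc 1 (completeSize d k)) :
    dendrimerDist d 1 v ≤ k := by
  induction k generalizing v with
  | zero =>
    simp only [completeSize, Set.Icc_self, Set.mem_singleton_iff] at hv
    rw [hv, dendrimerDist_self]
  | succ k ih =>
    rcases hv.1.eq_or_lt with rfl | h1
    · rw [dendrimerDist_self]; omega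
    · rw [dendrimerDist_parent_right hd le_rfl h1]
      have := ih ⟨dendrimerParent_pos d v, dendrimerParent_le_completeSize hd hv.2⟩
      omega

theorem dendrimerParent_completeSize_succ_add_one {d : ℕ} (hd : 2 ≤ d) (k : ℕ) :
    dendrimerParent d (completeSize d (k + 1) + 1) = completeSize d k + 1 := by
  rw [dendrimerParent_eq_iff hd (by simp [completeSize])]
  simp only [completeSize]
  omega

theorem dendrimerDist_one_completeSize_add_one {d : ℕ} (hd : 2 ≤ d) (k : ℕ) :
    dendrimerDist d 1 (completeSize d k + 1) = k + 1 := by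
  have h := completeSize_pos d k
  rw [dendrimerDist_parent_right hd le_rfl (by omega)]
  induction k with
  | zero => simp [completeSize, dendrimerParent_two, dendrimerDist_self]
  | succ k ih =>
    have h := completeSize_pos d k
    rw [dendrimerParent_completeSize_succ_add_one hd,
      dendrimerDist_parent_right hd le_rfl (by omega), ih h]

/-- The walk runs through the first node of each level, starting with `2` on level one. -/
theorem exists_walk_completeSize_add_one {d : ℕ} (hd : 2 ≤ d) {n : ℕ} (k : ℕ)
    (hn : completeSize d k + 1 ≤ n) :
    ∃ p : (dendrimerOnNat d n).Walk 1 (completeSize d k + 1), p.length = k + 1 ∧ 2 ∈ p.support := by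
  induction k with
  | zero =>
    have h : (dendrimerOnNat d n).Adj 1 2 :=
      (dendrimerOnNat_adj hd _ _ _).2 (Or.inl ⟨(dendrimerParent_two d).symm, le_rfl, hn⟩)
    exact ⟨h.toWalk, rfl, by simp [completeSize]⟩
  | succ k ih =>
    have hlt := completeSize_lt_succ hd k
    obtain ⟨p, hp, h2⟩ := ih (by omega)
    have h : (dendrimerOnNat d n).Adj (completeSize d k + 1) (completeSize d (k + 1) + 1) :=
      (dendrimerOnNat_adj hd _ _ _).2
        (Or.inl ⟨(dendrimerParent_completeSize_succ_add_one hd k).symm, by omega, hn⟩)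
    exact ⟨p.concat h, by rw [SimpleGraph.Walk.length_concat, hp],
      by rw [SimpleGraph.Walk.support_concat]; simp [h2]⟩

/-- Unreachable pairs have `dist` equal to `0`, so a nonzero level excludes the isolated numbers
outside the dendrimer. -/
theorem mem_Icc_of_dist_dendrimerOnNat_ne_zero {d n v : ℕ} (hd : 2 ≤ d)
    (h : (dendrimerOnNat d n).dist 1 v ≠ 0) : 1 ∈ Set.Icc 1 n ∧ v ∈ Set.Icc 1 n := by
  have hadj : ∀ x y, (dendrimerOnNat d n).Adj x y → x ∈ Set.Icc 1 n := by
    intro x y hxy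
    rw [dendrimerOnNat_adj hd] at hxy
    rcases hxy with ⟨rfl, h1, h2⟩ | ⟨rfl, h1, h2⟩
    · have := dendrimerParent_lt (d := d) h1
      exact ⟨dendrimerParent_pos _ _, by omega⟩
    · exact ⟨by omega, h2⟩
  obtain ⟨hne, hr⟩ := SimpleGraph.dist_ne_zero_iff_ne_and_reachable.1 h
  obtain ⟨p⟩ := hr
  refine ⟨?_, ?_⟩
  · cases p with
    | nil => exact absurd rfl hne
    | cons h _ => exact hadj _ _ h
  · cases p.reverse with
    | nil => exact absurd rfl hne
    | cons h _ => exact hadj _ _ h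

theorem completionIndex_eq {d : ℕ} (hd : 2 ≤ d) (k : ℕ) :
    completionIndex d k = completeSize d k + 1 := by
  have hdist : ∀ n v, (dendrimerOnNat d n).dist 1 v = k + 1 → completeSize d k < v ∧ v ≤ n := by
    intro n v h
    obtain ⟨h1, hv⟩ := mem_Icc_of_dist_dendrimerOnNat_ne_zero hd (by rw [h]; omega)
    refine ⟨?_, hv.2⟩
    by_contra hlt
    rw [dist_dendrimerOnNat hd h1 hv] at h
    have := dendrimerDist_one_le hd (k := k) ⟨hv.1, not_lt.1 hlt⟩
    omega
  have hmem : (descendantsOfTwoAtLevelSucc (completeSize d k + 1) d k).ncard = 1 := by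
    rw [Set.ncard_eq_one]
    refine ⟨completeSize d k + 1, Set.eq_singleton_iff_unique_mem.2 ⟨⟨?_, ?_⟩, ?_⟩⟩
    · rw [dist_dendrimerOnNat hd ⟨le_rfl, by omega⟩ ⟨by omega, le_rfl⟩,
        dendrimerDist_one_completeSize_add_one hd]
    · obtain ⟨p, hp, h2⟩ := exists_walk_completeSize_add_one hd k le_rfl
      refine ⟨p, p.isPath_of_length_eq_dist ?_, h2⟩
      rw [hp, dist_dendrimerOnNat hd ⟨le_rfl, by omega⟩ ⟨by omega, le_rfl⟩,
        dendrimerDist_one_completeSize_add_one hd]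
    · rintro v ⟨hv, -⟩
      have := hdist _ _ hv
      omega
  refine le_antisymm (Nat.sInf_le hmem) (le_csInf ⟨_, hmem⟩ ?_)
  intro n hn
  obtain ⟨v, hv⟩ := Set.ncard_eq_one.1 hn
  have hv' : v ∈ descendantsOfTwoAtLevelSucc n d k := hv ▸ Set.mem_singleton v
  have := hdist n v hv'.1
  omega

/-! ### The Wiener index as a sum over ordered pairs -/

/-- All edges end in `s`, so a walk starting in `s` never leaves it. -/
theorem induce_connected_dist {V : Type*} {G : SimpleGraph V} {s : Set V}
    (hs : ∀ x y, G.Adj x y → y ∈ s) (u v : s) (h : G.Reachable u v) :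
    (G.induce s).Reachable u v ∧ (G.induce s).dist u v = G.dist u v := by
  obtain ⟨p, hp⟩ := h.exists_walk_length_eq_dist
  have hsup : ∀ {a b : V} (q : G.Walk a b), a ∈ s → ∀ x ∈ q.support, x ∈ s := by
    intro a b q
    induction q with
    | nil => intro ha x hx; simp at hx; exact hx ▸ ha
    | cons h q ih =>
      intro ha x hx
      rw [SimpleGraph.Walk.support_cons, List.mem_cons] at hx
      rcases hx with rfl | hx
      · exact ha
      · exact ih (hs _ _ h) x hx
  have hq := hsup p u.2
  have hr : (G.induce s).Reachable u v := ⟨p.induce s hq⟩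
  refine ⟨hr, le_antisymm ?_ ?_⟩
  · have h1 := SimpleGraph.dist_le (p.induce s hq)
    have h2 := congrArg SimpleGraph.Walk.length (p.map_induce hq)
    rw [SimpleGraph.Walk.length_map] at h2
    rw [← hp]
    exact h1.trans h2.le
  · obtain ⟨q, hq⟩ := hr.exists_walk_length_eq_dist
    rw [← hq, ← SimpleGraph.Walk.length_map (SimpleGraph.Embedding.induce s).toHom q]
    exact SimpleGraph.dist_le _

theorem induce_dendrimer {d n : ℕ} (hd : 2 ≤ d) (u v : Set.Icc 1 n) :
    (dendrimer n d).Reachable u v ∧ (dendrimer n d).dist u v = dendrimerDist d u v := by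
  rw [← dist_dendrimerOnNat hd u.2 v.2]
  refine induce_connected_dist (fun x y hxy => ?_) u v (dendrimerOnNat_reachable hd u.2 v.2)
  rw [dendrimerOnNat_adj hd] at hxy
  rcases hxy with ⟨rfl, h1, h2⟩ | ⟨rfl, h1, h2⟩
  · exact ⟨by omega, h2⟩
  · have := dendrimerParent_lt (d := d) h1
    exact ⟨dendrimerParent_pos _ _, by omega⟩

theorem two_mul_sum_sym2_filter_not_isDiag {ι : Type*} [LinearOrder ι] (s : Finset ι)
    (f : ι → ι → ℕ) (hf : ∀ i j, f i j = f j i) (h0 : ∀ i, f i i = 0) :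
    2 * ∑ e ∈ s.sym2 with ¬ e.IsDiag, Sym2.lift ⟨f, hf⟩ e = ∑ i ∈ s, ∑ j ∈ s, f i j := by
  rw [Finset.sum_sym2_filter_not_isDiag]
  simp only [Sym2.lift_mk]
  have h1 : ∑ i ∈ s.offDiag with i.1 < i.2, f i.1 i.2 =
      ∑ i ∈ s, ∑ j ∈ s, if i < j then f i j else 0 := by
    rw [← Finset.sum_product', ← Finset.sum_filter]
    refine Finset.sum_congr ?_ fun _ _ => rfl
    ext ⟨a, b⟩
    simp only [Finset.mem_filter, Finset.mem_offDiag, Finset.mem_product]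
    exact ⟨fun h => ⟨⟨h.1.1, h.1.2.1⟩, h.2⟩, fun h => ⟨⟨h.1.1, h.1.2, h.2.ne⟩, h.2⟩⟩
  rw [h1, two_mul]
  nth_rewrite 2 [Finset.sum_comm]
  rw [← Finset.sum_add_distrib]
  refine Finset.sum_congr rfl fun i _ => ?_
  rw [← Finset.sum_add_distrib]
  refine Finset.sum_congr rfl fun j _ => ?_
  rcases lt_trichotomy i j with h | rfl | h
  · simp [h, h.not_gt]
  · simp [h0]
  · simp [h, h.not_gt, hf i j]

theorem two_mul_wienerIndex_dendrimer {d : ℕ} (hd : 2 ≤ d) (n : ℕ) :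
    2 * wienerIndex (dendrimer n d) =
      ∑ u ∈ Finset.Ioc 0 n, ∑ v ∈ Finset.Ioc 0 n, dendrimerDist d u v := by
  have h := two_mul_sum_sym2_filter_not_isDiag (Finset.univ : Finset (Set.Icc 1 n))
    (fun u v => (dendrimer n d).dist u v) (fun _ _ => SimpleGraph.dist_comm)
    (fun _ => SimpleGraph.dist_self)
  have hset : ∀ g : ℕ → ℕ, ∑ u : Set.Icc 1 n, g u = ∑ u ∈ Finset.Ioc 0 n, g u := by
    intro g
    refine (Finset.sum_subtype (Finset.Ioc 0 n) (fun x => ?_) g).symm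
    simp only [Finset.mem_Ioc, Set.mem_Icc]
    omega
  have h2 : ∑ u : Set.Icc 1 n, ∑ v : Set.Icc 1 n, (dendrimer n d).dist u v =
      ∑ u ∈ Finset.Ioc 0 n, ∑ v ∈ Finset.Ioc 0 n, dendrimerDist d u v := by
    simp only [(induce_dendrimer hd _ _).2]
    rw [← hset fun u => ∑ v ∈ Finset.Ioc 0 n, dendrimerDist d u v]
    exact Finset.sum_congr rfl fun u _ => hset fun v => dendrimerDist d u v
  rw [← h2, ← h, wienerIndex]
  congr 1
  refine Finset.sum_congr ?_ fun _ _ => rfl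
  ext e
  simp

/-! ### Distance sums over levels -/

theorem sum_Ioc_dendrimerParent {d : ℕ} (hd : 2 ≤ d) {a b : ℕ} (hab : a ≤ b) (g : ℕ → ℕ) :
    ∑ v ∈ Finset.Ioc (d * a + 2) (d * b + 2), g (dendrimerParent d v) =
      d * ∑ p ∈ Finset.Ioc a b, g p := by
  induction b, hab using Nat.le_induction with
  | base => simp
  | succ b hb ih =>
    have h1 : d * a ≤ d * b := Nat.mul_le_mul_left _ hb
    rw [Finset.sum_Ioc_succ_top (show a ≤ b from hb), mul_add d (∑ p ∈ Finset.Ioc a b, g p), ← ih,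
      ← Finset.sum_Ioc_consecutive _ (show d * a + 2 ≤ d * b + 2 by omega)
        (show d * b + 2 ≤ d * (b + 1) + 2 by rw [mul_add]; omega)]
    congr 1
    have hc : ∀ v ∈ Finset.Ioc (d * b + 2) (d * (b + 1) + 2),
        g (dendrimerParent d v) = g (b + 1) := by
      intro v hv
      rw [Finset.mem_Ioc, mul_add] at hv
      rw [(dendrimerParent_eq_iff (p := b) hd (by omega)).2 (by omega)]
    rw [Finset.sum_congr rfl hc, Finset.sum_const, Nat.card_Ioc, smul_eq_mul, mul_add]
    congr 1
    omega

/-- Each ordered pair gains `2` over its parents, except the `b - a` diagonal pairs; their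
correction is added on the left to avoid subtraction. -/
theorem sum_dendrimerDist_same_level {d a b : ℕ} (hd : 2 ≤ d)
    (hp : ∀ v ∈ Finset.Ioc a b, dendrimerParent d v ≤ a) :
    ∑ u ∈ Finset.Ioc a b, ∑ v ∈ Finset.Ioc a b, dendrimerDist d u v + 2 * (b - a) =
      ∑ u ∈ Finset.Ioc a b, ∑ v ∈ Finset.Ioc a b,
        dendrimerDist d (dendrimerParent d u) (dendrimerParent d v) + 2 * (b - a) ^ 2 := by
  have h : ∀ u ∈ Finset.Ioc a b, ∀ v ∈ Finset.Ioc a b,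
      dendrimerDist d u v + (if u = v then 2 else 0) =
        dendrimerDist d (dendrimerParent d u) (dendrimerParent d v) + 2 := by
    intro u hu v hv
    have hpu := hp u hu
    have hpv := hp v hv
    rw [Finset.mem_Ioc] at hu hv
    rcases lt_trichotomy u v with h | rfl | h
    · rw [if_neg h.ne, dendrimerDist_parent_parent hd h (by omega)]
    · simp [dendrimerDist_self]
    · rw [if_neg h.ne', dendrimerDist_comm, dendrimerDist_parent_parent hd h (by omega),
        dendrimerDist_comm]
  have h2 := Finset.sum_congr rfl fun u hu => Finset.sum_congr rfl (h u hu)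
  have h3 : ∑ u ∈ Finset.Ioc a b, ∑ v ∈ Finset.Ioc a b, (if u = v then 2 else 0) =
      2 * (b - a) := by
    rw [Finset.sum_congr rfl fun u hu => by rw [Finset.sum_ite_eq, if_pos hu],
      Finset.sum_const, Nat.card_Ioc, smul_eq_mul, mul_comm]
  simp only [Finset.sum_add_distrib] at h2
  rw [h3] at h2
  rw [h2]
  simp only [Finset.sum_const, Nat.card_Ioc, smul_eq_mul]
  ring

theorem sum_dendrimerDist_next_level {d a b : ℕ} (hd : 2 ≤ d) :
    ∑ u ∈ Finset.Ioc 0 a, ∑ v ∈ Finset.Ioc a b, dendrimerDist d u v =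
      ∑ u ∈ Finset.Ioc 0 a, ∑ v ∈ Finset.Ioc a b, dendrimerDist d u (dendrimerParent d v) +
        a * (b - a) := by
  have h : ∀ u ∈ Finset.Ioc 0 a, ∀ v ∈ Finset.Ioc a b,
      dendrimerDist d u v = dendrimerDist d u (dendrimerParent d v) + 1 := by
    intro u hu v hv
    rw [Finset.mem_Ioc] at hu hv
    exact dendrimerDist_parent_right hd (by omega) (by omega)
  rw [Finset.sum_congr rfl fun u hu => Finset.sum_congr rfl (h u hu)]
  simp [Finset.sum_add_distrib]

theorem sum_dendrimerDist_split (d : ℕ) {a b : ℕ} (hab : a ≤ b) :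
    ∑ u ∈ Finset.Ioc 0 b, ∑ v ∈ Finset.Ioc 0 b, dendrimerDist d u v =
      ∑ u ∈ Finset.Ioc 0 a, ∑ v ∈ Finset.Ioc 0 a, dendrimerDist d u v +
        2 * ∑ u ∈ Finset.Ioc 0 a, ∑ v ∈ Finset.Ioc a b, dendrimerDist d u v +
          ∑ u ∈ Finset.Ioc a b, ∑ v ∈ Finset.Ioc a b, dendrimerDist d u v := by
  have h : ∀ u, ∑ v ∈ Finset.Ioc 0 b, dendrimerDist d u v =
      ∑ v ∈ Finset.Ioc 0 a, dendrimerDist d u v + ∑ v ∈ Finset.Ioc a b, dendrimerDist d u v :=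
    fun u => (Finset.sum_Ioc_consecutive _ (Nat.zero_le a) hab).symm
  have hc : ∑ u ∈ Finset.Ioc a b, ∑ v ∈ Finset.Ioc 0 a, dendrimerDist d u v =
      ∑ u ∈ Finset.Ioc 0 a, ∑ v ∈ Finset.Ioc a b, dendrimerDist d u v := by
    rw [Finset.sum_comm]
    exact Finset.sum_congr rfl fun u _ => Finset.sum_congr rfl fun v _ => dendrimerDist_comm _ _ _
  rw [← Finset.sum_Ioc_consecutive _ (Nat.zero_le a) hab]
  simp only [h, Finset.sum_add_distrib]
  rw [hc]
  ring

/-! ### Recurrences and closed forms -/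

/-- The sum of the distances over all ordered pairs of nodes on level `k + 1`. -/
noncomputable def levelSum (d k : ℕ) : ℕ :=
  ∑ u ∈ Finset.Ioc (completeSize d k) (completeSize d (k + 1)),
    ∑ v ∈ Finset.Ioc (completeSize d k) (completeSize d (k + 1)), dendrimerDist d u v

/-- The sum of the distances between the nodes up to level `k` and those on level `k + 1`. -/
noncomputable def crossSum (d k : ℕ) : ℕ :=
  ∑ u ∈ Finset.Ioc 0 (completeSize d k),
    ∑ v ∈ Finset.Ioc (completeSize d k) (completeSize d (k + 1)), dendrimerDist d u v

/-- The sum of the distances over all ordered pairs of nodes up to level `k`. -/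
noncomputable def totalSum (d k : ℕ) : ℕ :=
  ∑ u ∈ Finset.Ioc 0 (completeSize d k), ∑ v ∈ Finset.Ioc 0 (completeSize d k),
    dendrimerDist d u v

theorem totalSum_succ {d : ℕ} (hd : 2 ≤ d) (k : ℕ) :
    totalSum d (k + 1) = totalSum d k + 2 * crossSum d k + levelSum d k :=
  sum_dendrimerDist_split d (completeSize_lt_succ hd k).le

theorem levelSum_succ {d : ℕ} (hd : 2 ≤ d) (k : ℕ) :
    levelSum d (k + 1) + 2 * (completeSize d (k + 2) - completeSize d (k + 1)) =
      d ^ 2 * levelSum d k + 2 * (completeSize d (k + 2) - completeSize d (k + 1)) ^ 2 := by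
  have hle := (completeSize_lt_succ hd k).le
  rw [levelSum, sum_dendrimerDist_same_level hd fun v hv =>
    dendrimerParent_le_completeSize hd (Finset.mem_Ioc.1 hv).2]
  congr 1
  rw [levelSum, pow_two, mul_assoc, Finset.mul_sum]
  refine Eq.trans (Finset.sum_congr rfl fun u _ => sum_Ioc_dendrimerParent hd hle
    fun p => dendrimerDist d (dendrimerParent d u) p) ?_
  exact sum_Ioc_dendrimerParent hd hle fun u => d * ∑ v ∈ Finset.Ioc (completeSize d k)
    (completeSize d (k + 1)), dendrimerDist d u v

/-- Parents of level `k + 2` fill level `k + 1`, and the other endpoint lies either up to level `k`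
(giving `crossSum`) or on level `k + 1` (giving `levelSum`). -/
theorem crossSum_succ {d : ℕ} (hd : 2 ≤ d) (k : ℕ) :
    crossSum d (k + 1) = d * (crossSum d k + levelSum d k) +
      completeSize d (k + 1) * (completeSize d (k + 2) - completeSize d (k + 1)) := by
  have hle := (completeSize_lt_succ hd k).le
  rw [crossSum, sum_dendrimerDist_next_level hd]
  congr 1
  rw [crossSum, levelSum, Finset.sum_Ioc_consecutive _ (Nat.zero_le _) hle, Finset.mul_sum]
  exact Finset.sum_congr rfl fun u _ => sum_Ioc_dendrimerParent hd hle _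

theorem levelSum_zero {d : ℕ} (hd : 2 ≤ d) : levelSum d 0 + 2 * (d + 1) = 2 * (d + 1) ^ 2 := by
  have hpar : ∀ v ∈ Finset.Ioc 1 (d + 2), dendrimerParent d v = 1 := fun v hv =>
    le_antisymm (dendrimerParent_le_completeSize (k := 0) hd (by
      simpa [completeSize] using (Finset.mem_Ioc.1 hv).2)) (dendrimerParent_pos d v)
  have h := sum_dendrimerDist_same_level hd fun v hv => (hpar v hv).le
  have h0 : ∑ u ∈ Finset.Ioc 1 (d + 2), ∑ v ∈ Finset.Ioc 1 (d + 2),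
      dendrimerDist d (dendrimerParent d u) (dendrimerParent d v) = 0 :=
    Finset.sum_eq_zero fun u hu => Finset.sum_eq_zero fun v hv => by
      rw [hpar u hu, hpar v hv, dendrimerDist_self]
  rw [h0] at h
  simpa [levelSum, completeSize] using h

theorem crossSum_zero {d : ℕ} (hd : 2 ≤ d) : crossSum d 0 = d + 1 := by
  have h : ∀ v ∈ Finset.Ioc 1 (d + 2), dendrimerDist d 1 v = 1 := fun v hv =>
    le_antisymm (dendrimerDist_one_le (k := 1) hd (by
        simp only [completeSize, Finset.mem_Ioc, Set.mem_Icc] at hv ⊢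
        omega))
      (by rw [dendrimerDist_parent_right hd le_rfl (Finset.mem_Ioc.1 hv).1]; omega)
  have h2 := Finset.sum_congr rfl h
  simpa [crossSum, completeSize] using h2

theorem totalSum_zero (d : ℕ) : totalSum d 0 = 0 := by
  simp [totalSum, completeSize, dendrimerDist_self]

/-- The three sums are coupled, so they are solved together. The third clause expresses the cross
sum through the closed form of the total at `k + 1`, which makes the induction step for the total
immediate. -/
theorem dendrimer_sums_eq {d : ℕ} (hd : 2 ≤ d) (k : ℕ) :
    (levelSum d k : ℚ) = 2 * (d + 1) * d ^ k *
        ((k + 1) * (d + 1) * d ^ k - (d * d ^ k - 1) / (d - 1)) ∧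
      (totalSum d k : ℚ) = 2 * (((d : ℚ) ^ k) ^ 2 *
        (k * d ^ 3 + (k - 2) * d ^ 2 - (k + 3) * d - (k + 1)) + 2 * d ^ k * (d + 1) ^ 2 - (d + 1)) /
          (d - 1) ^ 3 ∧
      2 * (crossSum d k : ℚ) = 2 * (((d : ℚ) * d ^ k) ^ 2 *
        ((k + 1) * d ^ 3 + (k - 1) * d ^ 2 - (k + 4) * d - (k + 2)) +
          2 * (d * d ^ k) * (d + 1) ^ 2 - (d + 1)) / (d - 1) ^ 3 - totalSum d k - levelSum d k := by
  have hD : (d : ℚ) - 1 ≠ 0 := by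
    have : (2 : ℚ) ≤ d := by exact_mod_cast hd
    linarith
  induction k with
  | zero =>
    have h1 : (levelSum d 0 : ℚ) + 2 * (d + 1) = 2 * (d + 1) ^ 2 := by
      exact_mod_cast levelSum_zero hd
    rw [totalSum_zero, crossSum_zero hd, eq_sub_of_add_eq h1]
    push_cast
    refine ⟨?_, ?_, ?_⟩
    · field_simp
      ring
    · field_simp
      ring
    · field_simp
      ring
  | succ k ih =>
    obtain ⟨hl, ht, hc⟩ := ih
    have hlt := (completeSize_lt_succ hd (k + 1)).le
    have hN := completeSize_mul_sub_one (d := d) (k + 1)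
    have hN2 := completeSize_mul_sub_one (d := d) (k + 2)
    have hs : ((completeSize d (k + 2) - completeSize d (k + 1) : ℕ) : ℚ) =
        (d + 1) * (d * d ^ k) := by
      rw [Nat.cast_sub hlt]
      apply mul_right_cancel₀ hD
      rw [pow_succ, pow_succ] at hN2
      rw [pow_succ] at hN
      linear_combination hN2 - hN
    have h1 : (levelSum d (k + 1) : ℚ) = d ^ 2 * levelSum d k +
        2 * ((d + 1) * (d * d ^ k)) ^ 2 - 2 * ((d + 1) * (d * d ^ k)) := by
      rw [← hs, eq_sub_iff_add_eq]
      exact_mod_cast levelSum_succ hd k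
    have h2 : (totalSum d (k + 1) : ℚ) = totalSum d k + 2 * crossSum d k + levelSum d k := by
      exact_mod_cast totalSum_succ hd k
    have h3 : (crossSum d (k + 1) : ℚ) = d * (crossSum d k + levelSum d k) +
        (((d : ℚ) + 1) * (d * d ^ k) - 2) / (d - 1) * ((d + 1) * (d * d ^ k)) := by
      rw [show ((d : ℚ) + 1) * (d * d ^ k) - 2 = completeSize d (k + 1) * ((d : ℚ) - 1) by
        rw [hN]; ring, mul_div_cancel_right₀ _ hD, ← hs]
      exact_mod_cast crossSum_succ hd k
    have h4 : 2 * (crossSum d (k + 1) : ℚ) = d * (2 * crossSum d k) + 2 * d * levelSum d k +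
        2 * ((((d : ℚ) + 1) * (d * d ^ k) - 2) / (d - 1) * ((d + 1) * (d * d ^ k))) := by
      rw [h3]; ring
    rw [h4, h2, h1, hc, hl, ht, pow_succ' (d : ℚ) k]
    -- What remains are identities of rational functions in `d`, `k` and `q`.
    generalize (d : ℚ) ^ k = q
    push_cast
    refine ⟨?_, ?_, ?_⟩
    · field_simp
      ring
    · field_simp
      ring
    · field_simp
      ring

theorem mainTheorem3 (d k : ℕ) (hd : 2 ≤ d) :
    (completionIndex d k : ℚ) = 2 + ((d : ℚ) + 1) * (((d : ℚ) ^ k - 1) / ((d : ℚ) - 1)) ∧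
    (dendrimer (completionIndex d k - 1) d).Connected ∧
    (wienerIndex (dendrimer (completionIndex d k - 1) d) : ℚ) =
      ((d : ℚ) ^ (2 * k) *
            ((k : ℚ) * (d : ℚ) ^ 3 + ((k : ℚ) - 2) * (d : ℚ) ^ 2
              - ((k : ℚ) + 3) * (d : ℚ) - ((k : ℚ) + 1))
          + 2 * (d : ℚ) ^ k * ((d : ℚ) + 1) ^ 2 - ((d : ℚ) + 1))
        / ((d : ℚ) - 1) ^ 3 := by
  have hD : (d : ℚ) - 1 ≠ 0 := by
    have : (2 : ℚ) ≤ d := by exact_mod_cast hd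
    linarith
  rw [completionIndex_eq hd, Nat.add_sub_cancel]
  refine ⟨?_, ?_, ?_⟩
  · have h := completeSize_mul_sub_one (d := d) k
    rw [← eq_div_iff hD] at h
    push_cast
    rw [h]
    field_simp
    ring
  · have : Nonempty (Set.Icc 1 (completeSize d k)) := ⟨⟨1, le_rfl, completeSize_pos d k⟩⟩
    exact ⟨fun u v => (induce_dendrimer hd u v).1⟩
  · have h : (2 : ℚ) * wienerIndex (dendrimer (completeSize d k) d) = totalSum d k := by
      exact_mod_cast two_mul_wienerIndex_dendrimer hd (completeSize d k)
    rw [(dendrimer_sums_eq hd k).2.1, mul_div_assoc] at h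
    rw [mul_left_cancel₀ two_ne_zero h, mul_comm 2 k, pow_mul]
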